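/- Let $X$ and $Y$ be Banach spaces over the same scalar field ($\mathbb{R}$ or $\mathbb{C}$), and let $K(X,Y)$ be the space of compact linear operators from $X$ to $Y$ with the operator norm. A vector $z$ of norm one in a Banach space $Z$ is called a smooth point of $Z$ if there is exactly one $f \in Z^{*}$ with $\|f\| = 1$ and $f(z) = 1$; it is called a very smooth point of $Z$ if its canonical image in $Z^{**}$ is a smooth point of $Z^{**}$. Let $T$ be a very smooth point of $K(X,Y)$. Then there is a unit vector $x_0 \in X$ with $\|T(x_0)\| = \|T\|$; it is unique up to constants, that is, every unit vector $x \in X$ with $\|T(x)\| = \|T\|$ is of the form $x = c\,x_0$ with a scalar $c$ of modulus one. Moreover, $T(x_0)$ is a very smooth point of $Y$. -/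

import Mathlib

/-- A unit vector `x` is a smooth point of `X` if there is exactly one functional of norm one
on `X` that takes the value `1` at `x`. -/
def IsSmoothPoint (𝕜 : Type*) {X : Type*} [RCLike 𝕜]
    [NormedAddCommGroup X] [NormedSpace 𝕜 X] (x : X) : Prop :=
  ‖x‖ = 1 ∧ ∃! f : StrongDual 𝕜 X, ‖f‖ = 1 ∧ f x = 1

/-- A unit vector `x` of `X` is a very smooth point of `X` if its canonical image in the
bidual of `X` is a smooth point of the bidual. -/
def IsVerySmoothPoint (𝕜 : Type*) {X : Type*} [RCLike 𝕜]
    [NormedAddCommGroup X] [NormedSpace 𝕜 X] (x : X) : Prop :=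
  ‖x‖ = 1 ∧ IsSmoothPoint 𝕜 (NormedSpace.inclusionInDoubleDual 𝕜 X x)

open Filter Topology NormedSpace

section

variable {𝕜 X Y : Type*} [RCLike 𝕜]
  [NormedAddCommGroup X] [NormedSpace 𝕜 X] [NormedAddCommGroup Y] [NormedSpace 𝕜 Y]

/-- A continuous functional of norm at most one that takes the value `1` at a unit vector has
norm one. -/
theorem norm_eq_one_of_apply_eq_one {x : X} {f : StrongDual 𝕜 X} (hx : ‖x‖ = 1) (hf : ‖f‖ ≤ 1)
    (hfx : f x = 1) : ‖f‖ = 1 := by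
  refine le_antisymm hf ?_
  simpa [hfx, hx] using f.le_opNorm x

theorem norm_inclusionInDoubleDual (x : X) : ‖inclusionInDoubleDual 𝕜 X x‖ = ‖x‖ :=
  (inclusionInDoubleDualLi 𝕜 (E := X)).norm_map x

/-- If `x` is a smooth point with norming functional `f`, then any sequence in the dual ball that
is asymptotically norming at `x` converges to `f` in the weak star topology. -/
theorem IsSmoothPoint.tendsto_apply {x : X} (hx : IsSmoothPoint 𝕜 x)
    {f : StrongDual 𝕜 X} (hf : ‖f‖ = 1) (hfx : f x = 1) {g : ℕ → StrongDual 𝕜 X}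
    (hg : ∀ n, ‖g n‖ ≤ 1) (hgx : Tendsto (fun n => g n x) atTop (𝓝 1)) (v : X) :
    Tendsto (fun n => g n v) atTop (𝓝 (f v)) := by
  have hlim : Tendsto (fun n => StrongDual.toWeakDual (g n)) atTop
      (𝓝 (StrongDual.toWeakDual f)) := by
    refine (WeakDual.isCompact_closedBall (𝕜 := 𝕜) (0 : StrongDual 𝕜 X)
      1).tendsto_nhds_of_unique_mapClusterPt ?_ ?_
    · refine Eventually.of_forall fun n => ?_
      simpa using hg n
    · intro F hF hFc
      have hF1 : ‖WeakDual.toStrongDual F‖ ≤ 1 := by simpa using hF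
      have hFx : WeakDual.toStrongDual F x = 1 := by
        have h1 := hFc.tendsto_comp ((WeakDual.eval_continuous (𝕜 := 𝕜) x).tendsto F)
        exact @eq_of_nhds_neBot _ _ _ _ _ (ClusterPt.mono h1 hgx)
      exact WeakDual.toStrongDual.injective (hx.2.unique
        ⟨norm_eq_one_of_apply_eq_one hx.1 hF1 hFx, hFx⟩ ⟨hf, hfx⟩)
  exact ((WeakDual.eval_continuous (𝕜 := 𝕜) v).tendsto _).comp hlim

/-- If `x` is a very smooth point with norming functional `f`, then any sequence of functionals
in the dual ball that is asymptotically norming at `x` converges weakly to `f`. -/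
theorem IsVerySmoothPoint.tendsto_apply {x : X} (hx : IsVerySmoothPoint 𝕜 x)
    {f : StrongDual 𝕜 X} (hf : ‖f‖ = 1) (hfx : f x = 1) {g : ℕ → StrongDual 𝕜 X}
    (hg : ∀ n, ‖g n‖ ≤ 1) (hgx : Tendsto (fun n => g n x) atTop (𝓝 1))
    (Φ : StrongDual 𝕜 (StrongDual 𝕜 X)) : Tendsto (fun n => Φ (g n)) atTop (𝓝 (Φ f)) :=
  hx.2.tendsto_apply (f := inclusionInDoubleDual 𝕜 (StrongDual 𝕜 X) f)
    (g := fun n => inclusionInDoubleDual 𝕜 (StrongDual 𝕜 X) (g n))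
    ((norm_inclusionInDoubleDual f).trans hf) hfx
    (fun n => (norm_inclusionInDoubleDual (g n)).trans_le (hg n)) hgx Φ

/-- The norming functional of a very smooth point is unique. -/
theorem IsVerySmoothPoint.eq_of_apply_eq_one {x : X} (hx : IsVerySmoothPoint 𝕜 x)
    {f g : StrongDual 𝕜 X} (hf : ‖f‖ ≤ 1) (hfx : f x = 1) (hg : ‖g‖ ≤ 1) (hgx : g x = 1) :
    f = g := by
  have hf' := norm_eq_one_of_apply_eq_one hx.1 hf hfx
  have hg' := norm_eq_one_of_apply_eq_one hx.1 hg hgx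
  exact (inclusionInDoubleDualLi 𝕜 (E := StrongDual 𝕜 X)).injective (hx.2.2.unique
    ⟨(norm_inclusionInDoubleDual f).trans hf', hfx⟩
    ⟨(norm_inclusionInDoubleDual g).trans hg', hgx⟩)

/-- A closed subspace is weakly sequentially closed. -/
theorem Submodule.mem_of_tendsto_dual_apply {p : Submodule 𝕜 X} (hp : IsClosed (p : Set X))
    {u : ℕ → X} (hu : ∀ n, u n ∈ p) {z : X}
    (h : ∀ Λ : StrongDual 𝕜 X, Tendsto (fun n => Λ (u n)) atTop (𝓝 (Λ z))) : z ∈ p := by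
  by_contra hz
  have hz' : p.mkQL z ≠ 0 := fun h0 => hz ((Submodule.Quotient.mk_eq_zero p).1 h0)
  obtain ⟨Λ, hΛ⟩ := SeparatingDual.exists_ne_zero (R := 𝕜) hz'
  refine hΛ (tendsto_nhds_unique (h (Λ.comp p.mkQL)) ?_)
  have h0 : ∀ n, p.mkQL (u n) = 0 := fun n => (Submodule.Quotient.mk_eq_zero p).2 (hu n)
  simp [h0]

/-- The range of an isometric embedding of a Banach space is weakly sequentially closed. -/
theorem LinearIsometry.exists_eq_of_tendsto_dual_apply [CompleteSpace X] (J : X →ₗᵢ[𝕜] Y)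
    {u : ℕ → X} {z : Y}
    (h : ∀ Λ : StrongDual 𝕜 Y, Tendsto (fun n => Λ (J (u n))) atTop (𝓝 (Λ z))) :
    ∃ x, J x = z :=
  Submodule.mem_of_tendsto_dual_apply (p := J.toLinearMap.range)
    J.isometry.isUniformInducing.isComplete_range.isClosed
    (fun n => LinearMap.mem_range_self _ (u n)) h

theorem isCompactOperator_smulRight (φ : StrongDual 𝕜 X) (y : Y) :
    IsCompactOperator (φ.smulRight y) :=
  (isCompactOperator_of_locallyCompactSpace_dom φ).clm_comp
    (ContinuousLinearMap.toSpanSingleton 𝕜 y)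

/-- A bounded family of operators with values in the range of an isometric embedding lifts along
that embedding. -/
theorem LinearIsometry.exists_lift {V E F : Type*} [NormedAddCommGroup V] [NormedSpace 𝕜 V]
    [NormedAddCommGroup E] [NormedSpace 𝕜 E] [NormedAddCommGroup F] [NormedSpace 𝕜 F]
    (ι : E →ₗᵢ[𝕜] F) (B : V →L[𝕜] F) (hB : ∀ v, ∃ S, ι S = B v) :
    ∃ A : V →L[𝕜] E, ∀ v, ι (A v) = B v := by
  choose A hA using hB
  refine ⟨LinearMap.mkContinuous ⟨⟨A, fun v w => ?_⟩, fun c v => ?_⟩ ‖B‖ fun v => ?_, hA⟩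
  · exact ι.injective (by simp [hA])
  · exact ι.injective (by simp [hA])
  · rw [← ι.norm_map]
    exact (congrArg norm (hA v)).trans_le (B.le_opNorm v)

theorem exists_unit_dual {y : Y} (hy : ‖y‖ = 1) : ∃ ψ : StrongDual 𝕜 Y, ‖ψ‖ = 1 ∧ ψ y = 1 := by
  obtain ⟨ψ, h1, h2⟩ := exists_dual_vector 𝕜 y (by simp [hy])
  exact ⟨ψ, h1, by simpa [hy] using h2⟩

/-- A surjective contraction maps a smooth point to a smooth point, if the image is a unit
vector. -/
theorem IsSmoothPoint.map {x : X} (hx : IsSmoothPoint 𝕜 x) (R : X →L[𝕜] Y)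
    (hR : ∀ v, ‖R v‖ ≤ ‖v‖) (hsurj : Function.Surjective R) (hRx : ‖R x‖ = 1) :
    IsSmoothPoint 𝕜 (R x) := by
  have hcomp : ∀ H : StrongDual 𝕜 Y, ‖H‖ = 1 ∧ H (R x) = 1 →
      ‖H.comp R‖ = 1 ∧ H.comp R x = 1 := by
    rintro H ⟨hH, hHx⟩
    refine ⟨norm_eq_one_of_apply_eq_one hx.1 ?_ hHx, hHx⟩
    refine ContinuousLinearMap.opNorm_le_bound _ zero_le_one fun v => ?_
    refine (H.le_opNorm (R v)).trans ?_
    rw [hH]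
    gcongr
    exact hR v
  obtain ⟨ψ, hψ⟩ := exists_unit_dual (𝕜 := 𝕜) hRx
  refine ⟨hRx, ψ, hψ, fun G hG => ContinuousLinearMap.ext fun y => ?_⟩
  obtain ⟨v, rfl⟩ := hsurj y
  exact DFunLike.congr_fun (hx.2.unique (hcomp G hG) (hcomp ψ hψ)) v

/-- The second adjoint of a contraction with a continuous linear right inverse is a surjective
contraction that extends it. -/
theorem exists_bidual_map (B : X →L[𝕜] Y) (hB : ∀ v, ‖B v‖ ≤ ‖v‖) (A : Y →L[𝕜] X)
    (hA : ∀ y, B (A y) = y) :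
    ∃ R : StrongDual 𝕜 (StrongDual 𝕜 X) →L[𝕜] StrongDual 𝕜 (StrongDual 𝕜 Y),
      (∀ Φ, ‖R Φ‖ ≤ ‖Φ‖) ∧ Function.Surjective R ∧
        ∀ x, R (inclusionInDoubleDual 𝕜 X x) = inclusionInDoubleDual 𝕜 Y (B x) := by
  refine ⟨ContinuousLinearMap.precomp 𝕜 (ContinuousLinearMap.precomp 𝕜 B),
    fun Φ => ?_, fun Ψ => ?_, fun x => rfl⟩
  · refine ContinuousLinearMap.opNorm_le_bound _ (ContinuousLinearMap.opNorm_nonneg Φ)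
      fun χ => ?_
    refine Φ.le_opNorm_of_le (x := χ.comp B) ?_
    refine ContinuousLinearMap.opNorm_le_bound _ (norm_nonneg _) fun v => ?_
    exact χ.le_opNorm_of_le (hB v)
  · refine ⟨Ψ.comp (ContinuousLinearMap.precomp 𝕜 A), ?_⟩
    refine ContinuousLinearMap.ext fun χ => congrArg Ψ (ContinuousLinearMap.ext fun y => ?_)
    exact congrArg χ (hA y)

/-- A contraction with a continuous linear right inverse maps a very smooth point to a very smooth
point, if the image is a unit vector. -/
theorem IsVerySmoothPoint.map {x : X} (hx : IsVerySmoothPoint 𝕜 x) (B : X →L[𝕜] Y)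
    (hB : ∀ v, ‖B v‖ ≤ ‖v‖) (A : Y →L[𝕜] X) (hA : ∀ y, B (A y) = y) (hBx : ‖B x‖ = 1) :
    IsVerySmoothPoint 𝕜 (B x) := by
  obtain ⟨R, hR, hsurj, hRJ⟩ := exists_bidual_map B hB A hA
  have hRx : ‖R (inclusionInDoubleDual 𝕜 X x)‖ = 1 := by
    rw [hRJ]
    exact (norm_inclusionInDoubleDual (B x)).trans hBx
  have hmap := @IsSmoothPoint.map 𝕜 (StrongDual 𝕜 (StrongDual 𝕜 X))
    (StrongDual 𝕜 (StrongDual 𝕜 Y)) _ _ _ _ _ _ hx.2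
  have hsm := hmap R hR hsurj hRx
  refine ⟨hBx, ?_⟩
  rw [← hRJ]
  exact hsm

/-- A compact operator of norm one has an asymptotically norming sequence in the unit ball whose
images converge. -/
theorem exists_seq_tendsto_norm_eq_one {T : X →L[𝕜] Y} (hT : IsCompactOperator T)
    (hT1 : ‖T‖ = 1) : ∃ (u : ℕ → X) (y : Y), (∀ n, ‖u n‖ ≤ 1) ∧ ‖y‖ = 1 ∧
      Tendsto (fun n => T (u n)) atTop (𝓝 y) := by
  have hx : ∀ n : ℕ, ∃ x : X, ‖x‖ < 1 ∧ 1 - 1 / ((n : ℝ) + 1) < ‖T x‖ := fun n =>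
    T.exists_lt_apply_of_lt_opNorm (by
      have : (0 : ℝ) < 1 / ((n : ℝ) + 1) := by positivity
      linarith)
  choose x hx1 hxT using hx
  obtain ⟨y, -, k, hk, hy⟩ := (hT.isCompact_closure_image_closedBall 1).tendsto_subseq
    (x := fun n => T (x n)) fun n => subset_closure ⟨x n, by simpa using (hx1 n).le, rfl⟩
  refine ⟨x ∘ k, y, fun n => (hx1 _).le, ?_, hy⟩
  refine tendsto_nhds_unique hy.norm (Tendsto.comp (g := fun n => ‖T (x n)‖) ?_ hk.tendsto_atTop)
  have hlow : Tendsto (fun n : ℕ => 1 - 1 / ((n : ℝ) + 1)) atTop (𝓝 1) := by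
    simpa using (tendsto_one_div_add_atTop_nhds_zero_nat (𝕜 := ℝ)).const_sub 1
  refine tendsto_of_tendsto_of_tendsto_of_le_of_le hlow tendsto_const_nhds
    (fun n => (hxT n).le) fun n => ?_
  calc ‖T (x n)‖ ≤ ‖T‖ * ‖x n‖ := T.le_opNorm _
    _ ≤ 1 := by rw [hT1, one_mul]; exact (hx1 n).le

section

/-! Results on a normed space `E` of operators, embedded isometrically by `ι` into `X →L[𝕜] Y`,
that contains the rank one operators. -/

variable {E : Type*} [NormedAddCommGroup E] [NormedSpace 𝕜 E]

/-- Evaluation at a vector, on a normed space of operators. -/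
noncomputable def operatorEval (ι : E →ₗᵢ[𝕜] X →L[𝕜] Y) (x : X) : E →L[𝕜] Y :=
  (ContinuousLinearMap.apply 𝕜 Y x).comp ι.toContinuousLinearMap

theorem operatorEval_apply (ι : E →ₗᵢ[𝕜] X →L[𝕜] Y) (x : X) (S : E) :
    operatorEval ι x S = ι S x := rfl

theorem norm_operatorEval_apply_le (ι : E →ₗᵢ[𝕜] X →L[𝕜] Y) (x : X) (S : E) :
    ‖operatorEval ι x S‖ ≤ ‖x‖ * ‖S‖ := by
  rw [mul_comm, ← ι.norm_map]
  exact (ι S).le_opNorm x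

theorem norm_comp_operatorEval_le (ι : E →ₗᵢ[𝕜] X →L[𝕜] Y) {x : X} (hx : ‖x‖ ≤ 1)
    {ψ : StrongDual 𝕜 Y} (hψ : ‖ψ‖ ≤ 1) : ‖ψ.comp (operatorEval ι x)‖ ≤ 1 := by
  refine ContinuousLinearMap.opNorm_le_bound _ zero_le_one fun S => ?_
  calc ‖ψ (operatorEval ι x S)‖ ≤ ‖ψ‖ * ‖operatorEval ι x S‖ := ψ.le_opNorm _
    _ ≤ 1 * (1 * ‖S‖) := by
        gcongr
        exact (norm_operatorEval_apply_le ι x S).trans (by gcongr)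
    _ = 1 * ‖S‖ := by ring

/-- A very smooth compact operator attains its norm. -/
theorem IsVerySmoothPoint.exists_norm_attained [CompleteSpace X]
    {ι : E →ₗᵢ[𝕜] X →L[𝕜] Y} {T : E} (hT : IsVerySmoothPoint 𝕜 T)
    (hι : ∀ (φ : StrongDual 𝕜 X) (y : Y), ∃ S, ι S = φ.smulRight y)
    (hc : IsCompactOperator (ι T)) : ∃ x₀ : X, ‖x₀‖ = 1 ∧ ‖ι T x₀‖ = 1 := by
  have hT1 : ‖ι T‖ = 1 := (ι.norm_map T).trans hT.1
  obtain ⟨u, y, hu, hy, hlim⟩ := exists_seq_tendsto_norm_eq_one hc hT1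
  obtain ⟨ψ, hψ, hψy⟩ := exists_unit_dual (𝕜 := 𝕜) hy
  obtain ⟨f, hf, hfT⟩ := exists_unit_dual (𝕜 := 𝕜) hT.1
  have hgT : Tendsto (fun n => ψ.comp (operatorEval ι (u n)) T) atTop (𝓝 1) :=
    hψy ▸ (ψ.continuous.tendsto y).comp hlim
  have hweak := hT.tendsto_apply hf hfT
    (fun n => norm_comp_operatorEval_le ι (hu n) hψ.le) hgT
  obtain ⟨A, hA'⟩ := ι.exists_lift ((ContinuousLinearMap.smulRightL 𝕜 X Y).flip y)
    fun φ => hι φ y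
  have hAι : ∀ φ, ι (A φ) = φ.smulRight y := hA'
  have hA : ∀ n, (ψ.comp (operatorEval ι (u n))).comp A = inclusionInDoubleDual 𝕜 X (u n) := by
    intro n
    ext φ
    simp [operatorEval_apply, hAι, hψy]
  obtain ⟨x₀, hx₀⟩ := (inclusionInDoubleDualLi 𝕜).exists_eq_of_tendsto_dual_apply
    (u := u) (z := f.comp A) fun Λ => by
      have := hweak (Λ.comp (ContinuousLinearMap.precomp 𝕜 A))
      refine this.congr fun n => ?_
      exact congrArg Λ (hA n)
  have hx₀le : ‖x₀‖ ≤ 1 := by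
    rw [← (inclusionInDoubleDualLi 𝕜).norm_map x₀, hx₀]
    refine ContinuousLinearMap.opNorm_le_bound _ zero_le_one fun φ => ?_
    have := f.le_opNorm (A φ)
    rwa [hf, ← ι.norm_map, hAι, ContinuousLinearMap.norm_smulRight_apply, hy, mul_one] at this
  have hval : ψ (ι T x₀) = 1 := by
    have h1 := hweak (inclusionInDoubleDual 𝕜 _ (A (ψ.comp (ι T))))
    have h2 : f (A (ψ.comp (ι T))) = ψ (ι T x₀) :=
      (DFunLike.congr_fun hx₀ (ψ.comp (ι T))).symm
    rw [dual_def, h2] at h1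
    refine tendsto_nhds_unique h1 (hgT.congr fun n => ?_)
    exact (DFunLike.congr_fun (hA n) (ψ.comp (ι T))).symm
  have hTx : 1 ≤ ‖ι T x₀‖ := by
    simpa [hval, hψ] using ψ.le_opNorm (ι T x₀)
  have hTx' : ‖ι T x₀‖ ≤ ‖x₀‖ := by
    simpa [hT1] using (ι T).le_opNorm x₀
  exact ⟨x₀, le_antisymm hx₀le (hTx.trans hTx'), le_antisymm (hTx'.trans hx₀le) hTx⟩

/-- The norming vectors of a very smooth compact operator are proportional. -/
theorem IsVerySmoothPoint.exists_eq_smul {ι : E →ₗᵢ[𝕜] X →L[𝕜] Y} {T : E}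
    (hT : IsVerySmoothPoint 𝕜 T)
    (hι : ∀ (φ : StrongDual 𝕜 X) (y : Y), ∃ S, ι S = φ.smulRight y) {x₀ x : X}
    (hx₀ : ‖x₀‖ = 1) (hTx₀ : ‖ι T x₀‖ = 1)
    (hx : ‖x‖ = 1) (hTx : ‖ι T x‖ = 1) : ∃ c : 𝕜, ‖c‖ = 1 ∧ x = c • x₀ := by
  obtain ⟨ψ₀, hψ₀, hψ₀T⟩ := exists_unit_dual (𝕜 := 𝕜) hTx₀
  obtain ⟨ψ, hψ, hψT⟩ := exists_unit_dual (𝕜 := 𝕜) hTx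
  have heq : ψ.comp (operatorEval ι x) = ψ₀.comp (operatorEval ι x₀) :=
    hT.eq_of_apply_eq_one (norm_comp_operatorEval_le ι hx.le hψ.le) hψT
      (norm_comp_operatorEval_le ι hx₀.le hψ₀.le) hψ₀T
  have hxc : x = ψ₀ (ι T x) • x₀ := by
    refine (inclusionInDoubleDualLi 𝕜 (E := X)).injective (ContinuousLinearMap.ext fun φ => ?_)
    change φ x = φ (ψ₀ (ι T x) • x₀)
    obtain ⟨S, hS⟩ := hι φ (ι T x)
    have h := DFunLike.congr_fun heq S
    simp only [ContinuousLinearMap.comp_apply, operatorEval_apply, hS,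
      ContinuousLinearMap.smulRight_apply, map_smul, hψT, smul_eq_mul, mul_one] at h
    rw [h, map_smul, smul_eq_mul, mul_comm]
  refine ⟨_, ?_, hxc⟩
  have := congrArg norm hxc
  rw [norm_smul, hx, hx₀, mul_one] at this
  exact this.symm

/-- The value of a very smooth compact operator at a norming vector is very smooth. -/
theorem IsVerySmoothPoint.isVerySmoothPoint_apply {ι : E →ₗᵢ[𝕜] X →L[𝕜] Y} {T : E}
    (hT : IsVerySmoothPoint 𝕜 T)
    (hι : ∀ (φ : StrongDual 𝕜 X) (y : Y), ∃ S, ι S = φ.smulRight y) {x₀ : X} (hx₀ : ‖x₀‖ = 1)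
    (hTx₀ : ‖ι T x₀‖ = 1) : IsVerySmoothPoint 𝕜 (ι T x₀) := by
  obtain ⟨φ, -, hφ⟩ := exists_unit_dual (𝕜 := 𝕜) hx₀
  obtain ⟨A, hA⟩ := ι.exists_lift (ContinuousLinearMap.smulRightL 𝕜 X Y φ) (hι φ)
  refine hT.map (operatorEval ι x₀) (fun S => ?_) A (fun y => ?_) hTx₀
  · simpa [hx₀] using norm_operatorEval_apply_le ι x₀ S
  · have hAy : ι (A y) = φ.smulRight y := hA y
    rw [operatorEval_apply, hAy, ContinuousLinearMap.smulRight_apply, hφ, one_smul]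

end

end

theorem corollary14 {𝕜 X Y : Type*} [RCLike 𝕜]
    [NormedAddCommGroup X] [NormedSpace 𝕜 X] [CompleteSpace X]
    [NormedAddCommGroup Y] [NormedSpace 𝕜 Y] [CompleteSpace Y]
    (T : compactOperator (RingHom.id 𝕜) X Y) (hT : IsVerySmoothPoint 𝕜 T) :
    ∃ x₀ : X, ‖x₀‖ = 1 ∧ ‖(T : X →L[𝕜] Y) x₀‖ = ‖T‖ ∧
      (∀ x : X, ‖x‖ = 1 → ‖(T : X →L[𝕜] Y) x‖ = ‖T‖ → ∃ c : 𝕜, ‖c‖ = 1 ∧ x = c • x₀) ∧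
      IsVerySmoothPoint 𝕜 ((T : X →L[𝕜] Y) x₀) := by
  let ι := (compactOperator (RingHom.id 𝕜) X Y).subtypeₗᵢ
  have hι : ∀ (φ : StrongDual 𝕜 X) (y : Y), ∃ S, ι S = φ.smulRight y := fun φ y =>
    ⟨⟨φ.smulRight y, isCompactOperator_smulRight φ y⟩, rfl⟩
  obtain ⟨x₀, hx₀, hTx₀⟩ := hT.exists_norm_attained (ι := ι) hι 
    (show IsCompactOperator (T : X →L[𝕜] Y) from T.2)
  exact ⟨x₀, hx₀, hTx₀.trans hT.1.symm,
    fun x hx hTx => hT.exists_eq_smul (ι := ι) hι hx₀ hTx₀ hx (hTx.trans hT.1),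
    hT.isVerySmoothPoint_apply (ι := ι) hι hx₀ hTx₀⟩
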